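/- Let $d,n,N,s\ge 1$ be integers, let $r_{\min}>0$, $\epsilon>0$ and $r_{\max}\in\mathbb{R}$, and let $X^{(1)},\dots,X^{(N)}\in\mathbb{R}^{d\times n}$ be input sequences whose tokens are their columns $X^{(i)}_{:,k}$. Put $\mathcal{V}^{(i)}=\{X^{(i)}_{:,k} : k\in[n]\}$ and $\mathcal{V}=\bigcup_{i\in[N]}\mathcal{V}^{(i)}$, and let $\|\cdot\|$ be the Euclidean norm. Assume that no sequence has a repeated token, that is, $X^{(i)}_{:,k}\ne X^{(i)}_{:,l}$ for all $i\in[N]$ and all $k\neq l$ in $[n]$, and that the sequences are tokenwise $(r_{\min},r_{\max},\epsilon)$-separated, that is, $r_{\min}<\|X^{(i)}_{:,k}\|<r_{\max}$ for all $i,k$, and $\|X^{(i)}_{:,k}-X^{(j)}_{:,l}\|>\epsilon$ whenever $X^{(i)}_{:,k}\ne X^{(j)}_{:,l}$. Then there exist matrices $W^{(O)}\in\mathbb{R}^{d\times s}$ and $W^{(V)},W^{(K)},W^{(Q)}\in\mathbb{R}^{s\times d}$, the last three of rank $1$, such that the single-head softmax self-attention layer $$\mathcal{F}(Z)=Z+W^{(O)}\left(W^{(V)}Z\right)\sigma_S\!\left[\left(W^{(K)}Z\right)^{\top}\left(W^{(Q)}Z\right)\right],$$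 where $\sigma_S$ is the softmax function applied to each column, is an $(r,\delta)$-contextual mapping for $X^{(1)},\dots,X^{(N)}$, that is: 1. $\|\mathcal{F}(X^{(i)})_{:,k}\|<r$ for all $i\in[N]$, $k\in[n]$; 2. $\|\mathcal{F}(X^{(i)})_{:,k}-\mathcal{F}(X^{(j)})_{:,l}\|>\delta$ for all $i,j\in[N]$ and $k,l\in[n]$ such that $\mathcal{V}^{(i)}\ne\mathcal{V}^{(j)}$ or $X^{(i)}_{:,k}\ne X^{(j)}_{:,l}$. Here $$r=r_{\max}+\frac{\epsilon}{4},\qquad \delta=\frac{2(\log n)^2\,\epsilon^2\, r_{\min}}{r_{\max}^2(|\mathcal{V}|+1)^4(2\log n+3)\pi d}\exp\!\left(-(|\mathcal{V}|+1)^4\,\frac{(2\log n+3)\pi d\, r_{\max}^2}{4\epsilon r_{\min}}\right).$$ -/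

import Mathlib

noncomputable section

/-- The Euclidean (`ℓ²`) norm of a real vector. -/
def l2Norm {m : ℕ} (v : Fin m → ℝ) : ℝ := ‖WithLp.toLp 2 v‖

/-- The softmax function on real vectors. -/
def softmax {n : ℕ} (v : Fin n → ℝ) : Fin n → ℝ :=
  fun k => Real.exp (v k) / ∑ l, Real.exp (v l)

/-- The softmax function applied to every column of a matrix. -/
def colSoftmax {m n : ℕ} (A : Matrix (Fin m) (Fin n) ℝ) : Matrix (Fin m) (Fin n) ℝ :=
  Matrix.of fun k l => softmax (A.col l) k

/-- Softmax dot-product self-attention with `h` heads of head size `s` and a skip connection: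
`Z + ∑ i, WO i (WV i Z) σ_S[(WK i Z)ᵀ (WQ i Z)]`. -/
def selfAttention {d n s h : ℕ} (WO : Fin h → Matrix (Fin d) (Fin s) ℝ)
    (WV WK WQ : Fin h → Matrix (Fin s) (Fin d) ℝ) (Z : Matrix (Fin d) (Fin n) ℝ) :
    Matrix (Fin d) (Fin n) ℝ :=
  Z + ∑ i, WO i * (WV i * Z) * colSoftmax ((WK i * Z).transpose * (WQ i * Z))

/-- The set of tokens (columns) of one sequence. -/
def seqVocabulary {d n : ℕ} (Z : Matrix (Fin d) (Fin n) ℝ) : Set (Fin d → ℝ) :=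
  Set.range fun k => Z.col k

/-- The set of all tokens occurring in a finite family of sequences. -/
def vocabulary {d n N : ℕ} (X : Fin N → Matrix (Fin d) (Fin n) ℝ) : Set (Fin d → ℝ) :=
  ⋃ i, seqVocabulary (X i)

/-- Tokenwise `(rmin, rmax, δ)`-separatedness of a finite family of sequences. -/
structure IsTokenwiseSeparated {m n N : ℕ} (Z : Fin N → Matrix (Fin m) (Fin n) ℝ)
    (rmin rmax δ : ℝ) : Prop where
  lower : ∀ i k, rmin < l2Norm ((Z i).col k)
  upper : ∀ i k, l2Norm ((Z i).col k) < rmax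
  separated : ∀ i j k l, (Z i).col k ≠ (Z j).col l → δ < l2Norm ((Z i).col k - (Z j).col l)

/-- `q` is an `(r, δ)`-contextual mapping for the sequences `X`. -/
structure IsContextualMapping {d n N : ℕ} (X : Fin N → Matrix (Fin d) (Fin n) ℝ)
    (q : Matrix (Fin d) (Fin n) ℝ → Matrix (Fin d) (Fin n) ℝ) (r δ : ℝ) : Prop where
  bounded : ∀ i k, l2Norm ((q (X i)).col k) < r
  separated : ∀ i j k l,
    seqVocabulary (X i) ≠ seqVocabulary (X j) ∨ (X i).col k ≠ (X j).col l →
      δ < l2Norm ((q (X i)).col k - (q (X j)).col l)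

end

/-! Outer-product weights reduce attention to scalars. Let `z l` be the inner product of token `l`
with a fixed vector `v`. Token `k` is then shifted along a fixed unit vector by `α` times the mean
of the `z l` under softmax weights with scores `κ * z l`, where `κ = β * z k`. When the projections
are distinct and `κ ≠ 0`, this mean is `boltzmann` of the scores divided by `κ`.

Distinct tokens stay apart through the skip connection: they are more than `ε` apart, and each shift
is at most `ε / 4`. For a token shared by sequences with different vocabularies `κ` is the same, so
the shifts differ by `α / |κ|` times a difference of Boltzmann values. `boltzmann_gap` bounds that
difference below: when the scores are spaced by `2 log n + 3`, the largest score at which the two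
sets differ outweighs everything beneath it.

The spacing comes from `exists_token_projection`. The bad directions `v` form one thin slab of the
unit ball per pair of points, and the slabs are too small to cover the ball. The origin is counted
among the points, so `|z k|` is bounded below too, and a large `β` stretches the scores to the
required spacing. -/

/-! ### Separation by the Boltzmann operator -/

/-- The Boltzmann operator of a finite set of reals: its mean under softmax weights. -/
noncomputable def boltzmann (A : Finset ℝ) : ℝ := (∑ x ∈ A, x * Real.exp x) / ∑ x ∈ A, Real.exp x

theorem sum_exp_pos {A : Finset ℝ} (hA : A.Nonempty) : 0 < ∑ x ∈ A, Real.exp x :=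
  Finset.sum_pos (fun x _ => Real.exp_pos x) hA

theorem sub_boltzmann {A : Finset ℝ} (hA : A.Nonempty) (u : ℝ) :
    u - boltzmann A = (∑ x ∈ A, (u - x) * Real.exp x) / ∑ x ∈ A, Real.exp x := by
  have h := (sum_exp_pos hA).ne'
  simp only [sub_mul, Finset.sum_sub_distrib, ← Finset.mul_sum, boltzmann]
  field_simp

theorem boltzmann_le {A : Finset ℝ} (hA : A.Nonempty) {u : ℝ} (h : ∀ x ∈ A, x ≤ u) :
    boltzmann A ≤ u := by
  rw [← sub_nonneg, sub_boltzmann hA]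
  exact div_nonneg (Finset.sum_nonneg fun x hx =>
    mul_nonneg (sub_nonneg.2 (h x hx)) (Real.exp_pos x).le) (sum_exp_pos hA).le

theorem le_boltzmann {A : Finset ℝ} (hA : A.Nonempty) {u : ℝ} (h : ∀ x ∈ A, u ≤ x) :
    u ≤ boltzmann A := by
  rw [← sub_nonpos, sub_boltzmann hA]
  exact div_nonpos_of_nonpos_of_nonneg (Finset.sum_nonpos fun x hx =>
    mul_nonpos_of_nonpos_of_nonneg (sub_nonpos.2 (h x hx)) (Real.exp_pos x).le) (sum_exp_pos hA).le

theorem mul_exp_neg_le_exp_neg_half (u : ℝ) : u * Real.exp (-u) ≤ Real.exp (-u / 2) := by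
  have h1 : u ≤ Real.exp (u / 2) := by
    have h2 := Real.add_one_le_exp (u / 2 - 1)
    have h3 : Real.exp (u / 2) = Real.exp (u / 2 - 1) * Real.exp 1 := by
      rw [← Real.exp_add]; ring_nf
    have h4 : (2 : ℝ) ≤ Real.exp 1 := by linarith [Real.add_one_le_exp (1 : ℝ)]
    nlinarith [Real.exp_pos (u / 2 - 1)]
  calc u * Real.exp (-u) ≤ Real.exp (u / 2) * Real.exp (-u) :=
        mul_le_mul_of_nonneg_right h1 (Real.exp_pos _).le
    _ = Real.exp (-u / 2) := by rw [← Real.exp_add]; ring_nf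

/-- Since `3 ≤ y`, `1 + u / y ≤ exp (u / 3)`: the linear factor costs only a third of the decay. -/
theorem add_mul_exp_neg_le {y u : ℝ} (hy : 3 ≤ y) (hu : 0 ≤ u) :
    (y + u) * Real.exp (-u) ≤ y * Real.exp (-(2 * u / 3)) := by
  have h1 : y + u ≤ y * Real.exp (u / 3) := by
    nlinarith [Real.add_one_le_exp (u / 3)]
  calc (y + u) * Real.exp (-u) ≤ y * Real.exp (u / 3) * Real.exp (-u) :=
        mul_le_mul_of_nonneg_right h1 (Real.exp_pos _).le
    _ = y * Real.exp (-(2 * u / 3)) := by rw [mul_assoc, ← Real.exp_add]; ring_nf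

theorem sq_le_two_mul_exp {l : ℝ} (hl : 0 ≤ l) : l ^ 2 ≤ 2 * Real.exp l := by
  linarith [Real.quadratic_le_exp_of_nonneg hl]

/-- If every element of `A` is at most `t ∈ A`, and `B` lies below `t` with a gap, then the
Boltzmann operator separates `A` from `B`. -/
theorem boltzmann_gap_of_isGreatest {A B : Finset ℝ} {n : ℕ} {R t : ℝ} (hn : 0 < n)
    (hA : A.card = n) (hBne : B.Nonempty) (htA : t ∈ A) (htR : t ≤ R)
    (hBR : ∀ x ∈ B, -R ≤ x)
    (hgA : ∀ x ∈ A, x ≠ t → x ≤ t - (2 * Real.log n + 3))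
    (hgB : ∀ x ∈ B, x ≤ t - (2 * Real.log n + 3)) :
    (Real.log n) ^ 2 * Real.exp (-2 * R) < boltzmann A - boltzmann B := by
  have hl : 0 ≤ Real.log n := Real.log_natCast_nonneg n
  have hn' : (0 : ℝ) < n := by exact_mod_cast hn
  have hexpl : Real.exp (Real.log n) = n := Real.exp_log hn'
  set l := Real.log n
  have hAne : A.Nonempty := ⟨t, htA⟩
  have h1 : boltzmann B ≤ t - (2 * l + 3) := boltzmann_le hBne hgB
  -- With `u = t - x ≥ 2 log n + 3`, each term is at most `exp t / n` because `u * exp (-u) ≤ exp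
  -- (-u / 2) ≤ 1 / n`.
  have h2 : t - boltzmann A ≤ 1 := by
    rw [sub_boltzmann hAne, div_le_one (sum_exp_pos hAne)]
    calc ∑ x ∈ A, (t - x) * Real.exp x ≤ ∑ x ∈ A, Real.exp t / n := by
          refine Finset.sum_le_sum fun x hx => ?_
          by_cases hxt : x = t
          · subst hxt; simp; positivity
          · have hx' := hgA x hx hxt
            have h3 := mul_exp_neg_le_exp_neg_half (t - x)
            have h4 : Real.exp (-(t - x) / 2) ≤ (n : ℝ)⁻¹ := by
              rw [← hexpl, ← Real.exp_neg]
              exact Real.exp_le_exp.2 (by linarith)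
            have h5 : Real.exp x = Real.exp (-(t - x)) * Real.exp t := by
              rw [← Real.exp_add]; ring_nf
            rw [h5, ← mul_assoc, div_eq_inv_mul]
            exact mul_le_mul_of_nonneg_right (h3.trans h4) (Real.exp_pos _).le
      _ = Real.exp t := by rw [Finset.sum_const, hA, nsmul_eq_mul]; field_simp
      _ ≤ ∑ x ∈ A, Real.exp x :=
          Finset.single_le_sum (f := Real.exp) (fun x _ => (Real.exp_pos x).le) htA
  obtain ⟨b, hb⟩ := hBne
  -- A gap of `2 * l + 3` fits between `-R` and `R`, so `l ≤ 2 * R`.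
  have h3 : Real.exp (-2 * R) ≤ Real.exp (-l) := by
    have := hBR b hb
    have := hgB b hb
    exact Real.exp_le_exp.2 (by linarith)
  have h4 : l ^ 2 * Real.exp (-2 * R) ≤ 2 := by
    calc l ^ 2 * Real.exp (-2 * R) ≤ 2 * Real.exp l * Real.exp (-l) :=
          mul_le_mul (sq_le_two_mul_exp hl) h3 (Real.exp_pos _).le (by positivity)
      _ = 2 := by rw [mul_assoc, ← Real.exp_add]; simp
  -- The difference is at least `2 * l + 2`, which exceeds `2` only for `l > 0`; at `l = 0` the left
  -- side vanishes.
  rcases hl.eq_or_lt with h0 | h0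
  · rw [← h0]; simp; linarith
  · linarith

/-- The Boltzmann operator separates two sets with the same elements above `t`, one of which
contains `t` while the other one only has smaller elements, with a gap, below. -/
theorem boltzmann_gap_of_common_top {C A' B' : Finset ℝ} {n : ℕ} {R t : ℝ} (hn : 0 < n)
    (hC : C.Nonempty) (hB' : B'.Nonempty) (hCn : C.card ≤ n) (hA'n : A'.card + 1 ≤ n)
    (hB'n : B'.card ≤ n)
    (htA : t ∉ A') (hCA : Disjoint C (insert t A')) (hCB : Disjoint C B')
    (hCR : ∀ x ∈ C, x ≤ R) (hBR : ∀ x ∈ B', -R ≤ x)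
    (hgC : ∀ x ∈ C, t + (2 * Real.log n + 3) ≤ x)
    (hgA : ∀ x ∈ A', x ≤ t)
    (hgB : ∀ x ∈ B', x ≤ t - (2 * Real.log n + 3)) :
    (Real.log n) ^ 2 * Real.exp (-2 * R) <
      boltzmann (C ∪ B') - boltzmann (C ∪ insert t A') := by
  have hl : 0 ≤ Real.log n := Real.log_natCast_nonneg n
  have hn' : (1 : ℝ) ≤ n := by exact_mod_cast hn
  have hexpl : Real.exp (Real.log n) = n := Real.exp_log (by linarith)
  set l := Real.log n
  have he1 : (2 : ℝ) ≤ Real.exp 1 := by linarith [Real.add_one_le_exp (1 : ℝ)]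
  set m := boltzmann C with hm
  set P := ∑ x ∈ C, Real.exp x with hP
  have hPpos : 0 < P := sum_exp_pos hC
  have hmt : t + (2 * l + 3) ≤ m := le_boltzmann hC hgC
  -- Deviations from the mean `m` of `C` cancel over `C`, so only the elements below the common top
  -- move the mean away from `m`.
  have hCw : ∑ x ∈ C, (m - x) * Real.exp x = 0 := by
    have := sub_boltzmann hC m
    rw [← hm, sub_self, eq_comm, div_eq_zero_iff] at this
    exact this.resolve_right hPpos.ne'
  set y := m - t with hy
  have hy3 : 3 ≤ y := by linarith
  have hw : 0 < y * Real.exp t := by positivity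
  have hexp3 : Real.exp (2 * l + 3) = n ^ 2 * Real.exp 1 ^ 3 := by
    rw [Real.exp_add, two_mul, Real.exp_add, hexpl, ← Real.exp_nat_mul]; norm_num; ring
  have he3 : (8 : ℝ) ≤ Real.exp 1 ^ 3 := by
    calc (8 : ℝ) = 2 ^ 3 := by norm_num
      _ ≤ _ := by gcongr
  have hPt : 8 * n ^ 2 * Real.exp t ≤ P := by
    obtain ⟨c, hc⟩ := hC
    calc 8 * n ^ 2 * Real.exp t ≤ Real.exp (2 * l + 3) * Real.exp t := by
          rw [hexp3, mul_comm (8 : ℝ)]; gcongr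
      _ = Real.exp (t + (2 * l + 3)) := by rw [← Real.exp_add]; ring_nf
      _ ≤ Real.exp c := Real.exp_le_exp.2 (hgC c hc)
      _ ≤ P := Finset.single_le_sum (f := Real.exp) (fun x _ => (Real.exp_pos x).le) hc
  -- The point `t` alone pulls the mean down by nearly `y * exp t / P`; `hB` shows that all of `B'`
  -- manages at most a quarter of this.
  have hA : 3 * (y * Real.exp t) / (4 * P) ≤ m - boltzmann (C ∪ insert t A') := by
    rw [sub_boltzmann (hC.inl), Finset.sum_union hCA, hCw, zero_add,
      Finset.sum_union hCA, Finset.sum_insert htA, ← hP]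
    have h1 : 0 ≤ ∑ x ∈ A', (m - x) * Real.exp x := Finset.sum_nonneg fun x hx =>
      mul_nonneg (by linarith [hgA x hx]) (Real.exp_pos x).le
    have h2 : ∑ x ∈ insert t A', Real.exp x ≤ n * Real.exp t := by
      calc ∑ x ∈ insert t A', Real.exp x ≤ (insert t A').card • Real.exp t := by
            refine Finset.sum_le_card_nsmul _ _ _ fun x hx => Real.exp_le_exp.2 ?_
            rcases Finset.mem_insert.1 hx with h | h
            · exact h.le
            · exact hgA x h
        _ ≤ n * Real.exp t := by
            rw [nsmul_eq_mul, Finset.card_insert_of_notMem htA]; gcongr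
    have h3 : 3 * (n * Real.exp t) ≤ P := by
      refine le_trans ?_ hPt
      nlinarith [Real.exp_pos t, mul_nonneg (sub_nonneg.2 hn') (Real.exp_pos t).le]
    have h4 : 0 < ∑ x ∈ insert t A', Real.exp x := sum_exp_pos (Finset.insert_nonempty _ _)
    rw [div_le_div_iff₀ (by positivity) (by positivity), ← hy]
    nlinarith
  have hB : m - boltzmann (C ∪ B') ≤ (y * Real.exp t) / (4 * P) := by
    rw [sub_boltzmann (hC.inl), Finset.sum_union hCB, hCw, zero_add,
      Finset.sum_union hCB, ← hP]
    have h1 : ∑ x ∈ B', (m - x) * Real.exp x ≤ y * Real.exp t / 4 := by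
      calc ∑ x ∈ B', (m - x) * Real.exp x ≤ B'.card • (y * Real.exp t / (4 * n)) := by
            refine Finset.sum_le_card_nsmul _ _ _ fun x hx => ?_
            have hx' := hgB x hx
            have h2 := add_mul_exp_neg_le hy3 (u := t - x) (by linarith)
            have h3 : Real.exp (-(2 * (t - x) / 3)) ≤ 1 / (4 * n) := by
              calc Real.exp (-(2 * (t - x) / 3)) ≤ Real.exp (-(l + 2)) :=
                    Real.exp_le_exp.2 (by linarith)
                _ = 1 / (Real.exp 1 ^ 2 * n) := by
                    rw [Real.exp_neg, Real.exp_add, hexpl, ← Real.exp_nat_mul, one_div, mul_comm]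
                    norm_num
                _ ≤ 1 / (4 * n) := by
                    gcongr
                    nlinarith
            have h5 : (m - x) * Real.exp x = (y + (t - x)) * Real.exp (-(t - x)) * Real.exp t := by
              rw [mul_assoc, ← Real.exp_add, hy]; ring_nf
            rw [h5]
            calc (y + (t - x)) * Real.exp (-(t - x)) * Real.exp t
                ≤ y * (1 / (4 * n)) * Real.exp t := by
                  refine mul_le_mul_of_nonneg_right (h2.trans ?_) (Real.exp_pos t).le
                  exact mul_le_mul_of_nonneg_left h3 (by linarith)
              _ = _ := by ring
        _ ≤ n * (y * Real.exp t / (4 * n)) := by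
            rw [nsmul_eq_mul]; gcongr
        _ = _ := by field_simp
    have h4 : 0 < ∑ x ∈ B', Real.exp x := sum_exp_pos hB'
    rw [div_le_div_iff₀ (by positivity) (by positivity)]
    nlinarith
  have hPR : P ≤ n * Real.exp R := by
    calc P ≤ C.card • Real.exp R :=
          Finset.sum_le_card_nsmul _ _ _ fun x hx => Real.exp_le_exp.2 (hCR x hx)
      _ ≤ _ := by rw [nsmul_eq_mul]; gcongr
  -- An element of `B'` lies above `-R` and a full gap below `t`, which keeps `t` away from `-R`.
  have htR : n ^ 2 * 8 * Real.exp (-R) ≤ Real.exp t := by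
    obtain ⟨b, hb⟩ := hB'
    have := hgB b hb
    have := hBR b hb
    calc n ^ 2 * 8 * Real.exp (-R) ≤ Real.exp (2 * l + 3) * Real.exp (-R) := by
          rw [hexp3]; gcongr
      _ = Real.exp (2 * l + 3 - R) := by rw [← Real.exp_add]; ring_nf
      _ ≤ Real.exp t := Real.exp_le_exp.2 (by linarith)
  have hl2 : l ^ 2 < 12 * n := by
    have := sq_le_two_mul_exp hl
    rw [hexpl] at this
    linarith
  calc l ^ 2 * Real.exp (-2 * R) < 12 * n * Real.exp (-2 * R) := by gcongr
    _ ≤ (y * Real.exp t) / (2 * P) := by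
        rw [le_div_iff₀ (by positivity)]
        calc 12 * n * Real.exp (-2 * R) * (2 * P)
            ≤ 12 * n * Real.exp (-2 * R) * (2 * (n * Real.exp R)) := by gcongr
          _ = 3 * (n ^ 2 * 8 * Real.exp (-R)) := by
              have : Real.exp (-2 * R) * Real.exp R = Real.exp (-R) := by
                rw [← Real.exp_add]; ring_nf
              rw [← this]; ring
          _ ≤ y * Real.exp t := by gcongr
    _ = 3 * (y * Real.exp t) / (4 * P) - (y * Real.exp t) / (4 * P) := by field_simp; norm_num
    _ ≤ _ := by linarith

/-- Here `t` is the largest point of difference. If nothing lies above it, `t` dominates `A`;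
otherwise the sets share a nonempty top, and the effect of `t` is compared with that of the rest of
`B`. -/
theorem boltzmann_gap_of_mem {A B : Finset ℝ} {n : ℕ} {R t : ℝ}
    (hA : A.card = n) (hB : B.card = n) (htA : t ∈ A) (htB : t ∉ B)
    (htop : ∀ x, t < x → (x ∈ A ↔ x ∈ B))
    (hAR : ∀ x ∈ A, |x| ≤ R) (hBR : ∀ x ∈ B, |x| ≤ R)
    (hgap : ∀ x ∈ A ∪ B, ∀ y ∈ A ∪ B, x ≠ y → 2 * Real.log n + 3 ≤ |x - y|) :
    (Real.log n) ^ 2 * Real.exp (-2 * R) < |boltzmann A - boltzmann B| := by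
  have hn : 0 < n := hA ▸ Finset.card_pos.2 ⟨t, htA⟩
  have hl : 0 ≤ Real.log n := Real.log_natCast_nonneg n
  have hgt : ∀ x ∈ A ∪ B, x < t → x ≤ t - (2 * Real.log n + 3) := fun x hx hxt => by
    have := hgap x hx t (Finset.mem_union_left _ htA) hxt.ne
    rw [abs_of_neg (by linarith)] at this
    linarith
  have hlt : ∀ x ∈ A ∪ B, t < x → t + (2 * Real.log n + 3) ≤ x := fun x hx hxt => by
    have := hgap x hx t (Finset.mem_union_left _ htA) hxt.ne'
    rw [abs_of_pos (by linarith)] at this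
    linarith
  by_cases hC : (A.filter (t < ·)).Nonempty
  · have hAeq : A = A.filter (t < ·) ∪ insert t (A.filter (· < t)) := by
      ext x
      simp only [Finset.mem_union, Finset.mem_filter, Finset.mem_insert]
      rcases lt_trichotomy x t with h | h | h
      · simp [h, h.ne, h.not_gt]
      · simp [h, htA]
      · simp [h, h.ne', h.not_gt]
    have hBeq : B = A.filter (t < ·) ∪ B.filter (· < t) := by
      ext x
      simp only [Finset.mem_union, Finset.mem_filter]
      rcases lt_trichotomy x t with h | h | h
      · simp [h, h.not_gt]
      · simp [h, htB]
      · simp [h, h.not_gt, htop x h]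
    have ht' : t ∉ A.filter (· < t) := by simp
    have hdA : Disjoint (A.filter (t < ·)) (insert t (A.filter (· < t))) := by
      rw [Finset.disjoint_left]
      intro x hx hx'
      simp only [Finset.mem_filter, Finset.mem_insert] at hx hx'
      rcases hx' with h | h
      · exact hx.2.ne' h
      · exact hx.2.not_gt h.2
    have hdB : Disjoint (A.filter (t < ·)) (B.filter (· < t)) := by
      rw [Finset.disjoint_left]
      intro x hx hx'
      exact (Finset.mem_filter.1 hx).2.not_gt (Finset.mem_filter.1 hx').2
    have hcA : A.card = (A.filter (t < ·)).card + ((A.filter (· < t)).card + 1) := by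
      rw [← Finset.card_insert_of_notMem ht', ← Finset.card_union_of_disjoint hdA, ← hAeq]
    have hcB : B.card = (A.filter (t < ·)).card + (B.filter (· < t)).card := by
      rw [← Finset.card_union_of_disjoint hdB, ← hBeq]
    -- Equal cardinalities force `B` to have an element below `t`, matching `t` itself.
    have key := boltzmann_gap_of_common_top (R := R) (t := t) hn hC
      (Finset.card_pos.1 (by omega) : (B.filter (· < t)).Nonempty) (by omega)
      (by omega : (A.filter (· < t)).card + 1 ≤ n) (by omega) ht' hdA hdB
      (fun x hx => (abs_le.1 (hAR x (Finset.mem_filter.1 hx).1)).2)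
      (fun x hx => (abs_le.1 (hBR x (Finset.mem_filter.1 hx).1)).1)
      (fun x hx => hlt x (Finset.mem_union_left _ (Finset.mem_filter.1 hx).1)
        (Finset.mem_filter.1 hx).2)
      (fun x hx => (Finset.mem_filter.1 hx).2.le)
      (fun x hx => hgt x (Finset.mem_union_right _ (Finset.mem_filter.1 hx).1)
        (Finset.mem_filter.1 hx).2)
    rw [← hAeq, ← hBeq] at key
    rw [abs_sub_comm]
    exact key.trans_le (le_abs_self _)
  · rw [Finset.not_nonempty_iff_eq_empty, Finset.filter_eq_empty_iff] at hC
    refine (boltzmann_gap_of_isGreatest hn hA (Finset.card_pos.1 (hB ▸ hn)) htA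
      (abs_le.1 (hAR t htA)).2 (fun x hx => (abs_le.1 (hBR x hx)).1) ?_ ?_).trans_le
      (le_abs_self _)
    · exact fun x hx hxt => hgt x (Finset.mem_union_left _ hx) (lt_of_le_of_ne (not_lt.1 (hC hx)) hxt)
    · intro x hx
      refine hgt x (Finset.mem_union_right _ hx) (lt_of_le_of_ne (not_lt.1 fun h => ?_) ?_)
      · exact hC ((htop x h).2 hx) h
      · rintro rfl; exact htB hx

/-- The Boltzmann operator separates distinct sets of `n` reals with gaps at least
`2 log n + 3`. -/
theorem boltzmann_gap {A B : Finset ℝ} {n : ℕ} {R : ℝ}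
    (hA : A.card = n) (hB : B.card = n) (hAB : A ≠ B)
    (hAR : ∀ x ∈ A, |x| ≤ R) (hBR : ∀ x ∈ B, |x| ≤ R)
    (hgap : ∀ x ∈ A ∪ B, ∀ y ∈ A ∪ B, x ≠ y → 2 * Real.log n + 3 ≤ |x - y|) :
    (Real.log n) ^ 2 * Real.exp (-2 * R) < |boltzmann A - boltzmann B| := by
  have hne : (symmDiff A B).Nonempty := by
    rw [Finset.nonempty_iff_ne_empty]
    exact fun h => hAB (symmDiff_eq_bot.1 h)
  have ht := Finset.max'_mem _ hne
  have htop : ∀ x, (symmDiff A B).max' hne < x → (x ∈ A ↔ x ∈ B) := fun x hx => by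
    by_contra h
    refine hx.not_ge (Finset.le_max' _ x ?_)
    rw [Finset.mem_symmDiff]
    tauto
  rcases Finset.mem_symmDiff.1 ht with ⟨h1, h2⟩ | ⟨h1, h2⟩
  · exact boltzmann_gap_of_mem hA hB h1 h2 htop hAR hBR hgap
  · rw [abs_sub_comm]
    exact boltzmann_gap_of_mem hB hA h1 h2 (fun x hx => (htop x hx).symm) hBR hAR
      (by rwa [Finset.union_comm])

/-! ### Slab volumes and a well-spread projection -/

open MeasureTheory in
-- The slab sits inside the cylinder over the `m`-dimensional unit ball, since dropping a coordinate
-- does not increase the norm.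
theorem volume_slab_basis_le (m : ℕ) (c : ℝ) :
    volume {y : EuclideanSpace ℝ (Fin (m + 1)) | ‖y‖ < 1 ∧ |y 0| < c} ≤
      ENNReal.ofReal (2 * c) * volume (Metric.ball (0 : EuclideanSpace ℝ (Fin m)) 1) := by
  have h1 := (volume_preserving_piFinSuccAbove (fun _ : Fin (m + 1) => ℝ) 0).comp
    (PiLp.volume_preserving_ofLp (Fin (m + 1)))
  have h2 : MeasurePreserving
      (Prod.map id (WithLp.toLp 2) : ℝ × (Fin m → ℝ) → ℝ × EuclideanSpace ℝ (Fin m))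
      volume volume :=
    (MeasurePreserving.id volume).prod (PiLp.volume_preserving_toLp (Fin m))
  have h3 := h2.comp h1
  set S : Set (ℝ × EuclideanSpace ℝ (Fin m)) := Set.Ioo (-c) c ×ˢ Metric.ball 0 1
  have hS : MeasurableSet S := measurableSet_Ioo.prod measurableSet_ball
  calc _ ≤ volume ((Prod.map id (WithLp.toLp 2) ∘
          MeasurableEquiv.piFinSuccAbove (fun _ : Fin (m + 1) => ℝ) 0 ∘ WithLp.ofLp) ⁻¹' S) := by
        refine measure_mono fun y hy => ?_
        simp only [Set.mem_preimage, Function.comp_apply, S, Set.mem_prod, Set.mem_Ioo,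
          Prod.map_fst, Prod.map_snd, mem_ball_zero_iff]
        refine ⟨abs_lt.1 hy.2, lt_of_le_of_lt ?_ hy.1⟩
        rw [EuclideanSpace.norm_eq, EuclideanSpace.norm_eq]
        refine Real.sqrt_le_sqrt ?_
        rw [Fin.sum_univ_succ]
        refine le_trans (le_of_eq ?_) (le_add_of_nonneg_left (sq_nonneg _))
        rfl
    _ = volume S := h3.measure_preimage hS.nullMeasurableSet
    _ = _ := by
        rw [Measure.volume_eq_prod, Measure.prod_prod, Real.volume_Ioo]
        ring_nf

open MeasureTheory in
-- An isometry taking `e` to the first basis vector preserves volume.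
theorem volume_slab_le (m : ℕ) (c : ℝ) {e : EuclideanSpace ℝ (Fin (m + 1))} (he : ‖e‖ = 1) :
    volume {y : EuclideanSpace ℝ (Fin (m + 1)) | ‖y‖ < 1 ∧ |inner ℝ e y| < c} ≤
      ENNReal.ofReal (2 * c) * volume (Metric.ball (0 : EuclideanSpace ℝ (Fin m)) 1) := by
  obtain ⟨b, hb⟩ := Orthonormal.exists_orthonormalBasis_extension_of_card_eq (𝕜 := ℝ)
    (E := EuclideanSpace ℝ (Fin (m + 1))) (ι := Fin (m + 1)) (by simp) (v := fun _ => e)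
    (s := {0}) (by
      refine ⟨fun i => he, fun i j hij => ?_⟩
      exact absurd (Subtype.ext (i.2.trans j.2.symm)) hij)
  have hb0 : b 0 = e := hb 0 rfl
  refine le_trans (le_of_eq ?_) (volume_slab_basis_le m c)
  have hS : MeasurableSet {y : EuclideanSpace ℝ (Fin (m + 1)) | ‖y‖ < 1 ∧ |y 0| < c} := by
    apply IsOpen.measurableSet
    exact (isOpen_lt continuous_norm continuous_const).inter
      (isOpen_lt (EuclideanSpace.proj (0 : Fin (m + 1)) : _ →L[ℝ] ℝ).continuous.abs
        continuous_const)
  rw [← b.measurePreserving_repr.measure_preimage hS.nullMeasurableSet]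
  congr 1
  ext y
  simp [b.repr_apply_apply, hb0]

/-- Log-convexity of `Γ` at the midpoint of `x` and `x + 1`. -/
theorem Gamma_add_half_sq_le {x : ℝ} (hx : 0 < x) :
    Real.Gamma (x + 1 / 2) ^ 2 ≤ x * Real.Gamma x ^ 2 := by
  have h := Real.Gamma_mul_add_mul_le_rpow_Gamma_mul_rpow_Gamma hx (t := x + 1) (by linarith)
    (a := 1 / 2) (b := 1 / 2) (by norm_num) (by norm_num) (by norm_num)
  rw [← Real.sqrt_eq_rpow, ← Real.sqrt_eq_rpow, Real.Gamma_add_one hx.ne'] at h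
  have hG := Real.Gamma_pos_of_pos hx
  rw [← Real.sqrt_mul hG.le] at h
  have h2 : (1 / 2 * x + 1 / 2 * (x + 1)) = x + 1 / 2 := by ring
  rw [h2] at h
  calc Real.Gamma (x + 1 / 2) ^ 2 ≤ √(Real.Gamma x * (x * Real.Gamma x)) ^ 2 := by
        have := Real.Gamma_pos_of_pos (show 0 < x + 1 / 2 by linarith)
        gcongr
    _ = _ := by rw [Real.sq_sqrt (by positivity)]; ring

open MeasureTheory in
/-- Volumes of unit balls in consecutive dimensions. -/
theorem mul_volume_ball_lt (m : ℕ) {c : ℝ} (hc : 0 < c) (h : c ^ 2 * (m + 2) < 2 * Real.pi) :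
    ENNReal.ofReal c * volume (Metric.ball (0 : EuclideanSpace ℝ (Fin m)) 1) <
      volume (Metric.ball (0 : EuclideanSpace ℝ (Fin (m + 1))) 1) := by
  have hpi := Real.pi_pos
  have hG1 : 0 < Real.Gamma ((m : ℝ) / 2 + 1) := Real.Gamma_pos_of_pos (by positivity)
  have hG2 : 0 < Real.Gamma ((m : ℝ) / 2 + 1 + 1 / 2) := Real.Gamma_pos_of_pos (by positivity)
  have hs : (m : ℝ) / 2 + 1 + 1 / 2 = ((m + 1 : ℕ) : ℝ) / 2 + 1 := by push_cast; ring
  have hG := Gamma_add_half_sq_le (x := (m : ℝ) / 2 + 1) (by positivity)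
  rw [hs] at hG hG2
  have hcG : c * Real.Gamma (((m + 1 : ℕ) : ℝ) / 2 + 1) <
      √Real.pi * Real.Gamma ((m : ℝ) / 2 + 1) := by
    refine lt_of_pow_lt_pow_left₀ 2 (by positivity) ?_
    rw [mul_pow, mul_pow, Real.sq_sqrt hpi.le]
    calc c ^ 2 * Real.Gamma (((m + 1 : ℕ) : ℝ) / 2 + 1) ^ 2
        ≤ c ^ 2 * (((m : ℝ) / 2 + 1) * Real.Gamma ((m : ℝ) / 2 + 1) ^ 2) := by gcongr
      _ = c ^ 2 * (m + 2) / 2 * Real.Gamma ((m : ℝ) / 2 + 1) ^ 2 := by ring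
      _ < Real.pi * Real.Gamma ((m : ℝ) / 2 + 1) ^ 2 := by gcongr; linarith
  have hreal : c * (√Real.pi ^ m / Real.Gamma ((m : ℝ) / 2 + 1)) <
      √Real.pi ^ (m + 1) / Real.Gamma (((m + 1 : ℕ) : ℝ) / 2 + 1) := by
    rw [← mul_div_assoc, div_lt_div_iff₀ hG1 hG2, pow_succ]
    have : 0 < √Real.pi ^ m := by positivity
    nlinarith
  rcases Nat.eq_zero_or_pos m with rfl | hm
  · rw [EuclideanSpace.volume_ball (Fin (0 + 1))]
    simp only [CharP.cast_eq_zero, pow_zero, zero_div, zero_add, Real.Gamma_one, div_one,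
      mul_one] at hreal
    rw [volume_euclideanSpace_eq_dirac, Measure.dirac_apply_of_mem (by simp)]
    simp only [Fintype.card_fin, ENNReal.ofReal_one, one_pow, mul_one, one_mul]
    exact (ENNReal.ofReal_lt_ofReal_iff_of_nonneg hc.le).2 hreal
  · have : Nonempty (Fin m) := ⟨⟨0, hm⟩⟩
    rw [EuclideanSpace.volume_ball, EuclideanSpace.volume_ball]
    simp only [Fintype.card_fin, ENNReal.ofReal_one, one_pow, one_mul]
    rw [← ENNReal.ofReal_mul hc.le]
    exact (ENNReal.ofReal_lt_ofReal_iff_of_nonneg (by positivity)).2 hreal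

open MeasureTheory in
/-- A vector of the unit ball along which the distances between `M` points shrink by a factor
of at most `√(8 / (π d)) / M ^ 2`. -/
theorem exists_projection {d M : ℕ} (hd : 1 ≤ d) (hM : 2 ≤ M) (w : Fin M → EuclideanSpace ℝ (Fin d))
    (hw : Function.Injective w) :
    ∃ v : EuclideanSpace ℝ (Fin d), ‖v‖ < 1 ∧ ∀ i j,
      √(8 / (Real.pi * d)) / M ^ 2 * ‖w i - w j‖ ≤ |inner ℝ (w i - w j) v| := by
  obtain ⟨m, rfl⟩ : ∃ m, d = m + 1 := ⟨d - 1, by omega⟩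
  have hpi := Real.pi_pos
  have hpi3 := Real.pi_gt_three
  set c : ℝ := √(8 / (Real.pi * ((m + 1 : ℕ) : ℝ))) / M ^ 2 with hc
  have hM' : (2 : ℝ) ≤ M := by exact_mod_cast hM
  have hcpos : 0 < c := by positivity
  set slab : Fin M → Fin M → Set (EuclideanSpace ℝ (Fin (m + 1))) := fun i j =>
    {y | ‖y‖ < 1 ∧ |inner ℝ (‖w i - w j‖⁻¹ • (w i - w j)) y| < c} with hslab
  have hvol : volume (⋃ i : Fin M, ⋃ j ∈ Finset.Iio i, slab i j) <
      volume (Metric.ball (0 : EuclideanSpace ℝ (Fin (m + 1))) 1) := by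
    set K := volume (Metric.ball (0 : EuclideanSpace ℝ (Fin m)) 1)
    -- There are `M (M - 1) / 2` unordered pairs, each costing a slab of width `2 * c`.
    calc volume (⋃ i : Fin M, ⋃ j ∈ Finset.Iio i, slab i j)
        ≤ ∑ i : Fin M, volume (⋃ j ∈ Finset.Iio i, slab i j) := measure_iUnion_fintype_le _ _
      _ ≤ ∑ i : Fin M, ∑ j ∈ Finset.Iio i, volume (slab i j) :=
          Finset.sum_le_sum fun i _ => measure_biUnion_finset_le _ _
      _ ≤ ∑ i : Fin M, ∑ j ∈ Finset.Iio i, ENNReal.ofReal (2 * c) * K := by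
          refine Finset.sum_le_sum fun i _ => Finset.sum_le_sum fun j hj => ?_
          refine volume_slab_le m c ?_
          have : w i - w j ≠ 0 := sub_ne_zero.2 (hw.ne (Finset.mem_Iio.1 hj).ne')
          rw [norm_smul, norm_inv, norm_norm, inv_mul_cancel₀ (norm_ne_zero_iff.2 this)]
      _ = ENNReal.ofReal (M * (M - 1) * c) * K := by
          simp only [Finset.sum_const, Fin.card_Iio, nsmul_eq_mul, ← Finset.sum_mul]
          rw [← mul_assoc]
          congr 1
          rw [Fin.sum_univ_eq_sum_range (fun i => (i : ENNReal)), ← Nat.cast_sum,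
            ← ENNReal.ofReal_natCast, ← ENNReal.ofReal_mul (by positivity)]
          congr 1
          have h := Finset.sum_range_id_mul_two M
          have h' : ((∑ i ∈ Finset.range M, i : ℕ) : ℝ) * 2 = M * (M - 1) := by
            rw [← Nat.cast_ofNat, ← Nat.cast_mul, h, Nat.cast_mul, Nat.cast_sub (by omega)]
            simp
          rw [← h']; ring
      _ < _ := by
          refine mul_volume_ball_lt m (by have : 0 < (M : ℝ) - 1 := by linarith
                                          positivity) ?_
          have h1 : c ^ 2 * ((M : ℝ) ^ 2) ^ 2 * (Real.pi * (m + 1)) = 8 := by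
            rw [hc, div_pow, Real.sq_sqrt (by positivity)]
            push_cast
            field_simp
          have h2 : ((M : ℝ) * (M - 1) * c) ^ 2 ≤ c ^ 2 * ((M : ℝ) ^ 2) ^ 2 := by
            rw [mul_pow, mul_comm]
            gcongr <;> nlinarith
          -- From `m + 2 ≤ 2 (m + 1)`; the volume comparison then needs only `16 < 2 π²`.
          have h3 : ((M : ℝ) * (M - 1) * c) ^ 2 * (m + 2) * Real.pi ≤ 16 := by
            calc _ ≤ c ^ 2 * ((M : ℝ) ^ 2) ^ 2 * (2 * (m + 1)) * Real.pi := by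
                  gcongr
                  have : (0 : ℝ) ≤ m := Nat.cast_nonneg m
                  linarith
              _ = 2 * (c ^ 2 * ((M : ℝ) ^ 2) ^ 2 * (Real.pi * (m + 1))) := by ring
              _ = 16 := by rw [h1]; norm_num
          nlinarith
  obtain ⟨v, hv1, hv2⟩ : ∃ v ∈ Metric.ball (0 : EuclideanSpace ℝ (Fin (m + 1))) 1,
      v ∉ ⋃ i : Fin M, ⋃ j ∈ Finset.Iio i, slab i j := by
    by_contra! h
    exact hvol.not_ge (measure_mono h)
  rw [mem_ball_zero_iff] at hv1
  have hlt : ∀ i j, j < i → c * ‖w i - w j‖ ≤ |inner ℝ (w i - w j) v| := by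
    intro i j hij
    have hpos : 0 < ‖w i - w j‖ := norm_pos_iff.2 (sub_ne_zero.2 (hw.ne hij.ne'))
    by_contra! h
    refine hv2 (Set.mem_iUnion.2 ⟨i, Set.mem_iUnion₂.2 ⟨j, Finset.mem_Iio.2 hij, hv1, ?_⟩⟩)
    rw [real_inner_smul_left, abs_mul, abs_inv, abs_norm, inv_mul_lt_iff₀ hpos]
    linarith
  refine ⟨v, hv1, fun i j => ?_⟩
  rcases lt_trichotomy i j with h | rfl | h
  · have := hlt j i h
    rwa [norm_sub_rev, ← neg_sub (w i), inner_neg_left, abs_neg] at this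
  · simp
  · exact hlt i j h

/-! ### Softmax averages and rank-one attention -/

theorem softmax_nonneg {n : ℕ} (v : Fin n → ℝ) (k : Fin n) : 0 ≤ softmax v k :=
  div_nonneg (Real.exp_pos _).le (Finset.sum_nonneg fun _ _ => (Real.exp_pos _).le)

theorem sum_softmax {n : ℕ} [NeZero n] (v : Fin n → ℝ) : ∑ k, softmax v k = 1 := by
  unfold softmax
  rw [← Finset.sum_div]
  exact div_self (Finset.sum_pos (fun _ _ => Real.exp_pos _) Finset.univ_nonempty).ne'

theorem abs_sum_mul_softmax_le {n : ℕ} [NeZero n] {z : Fin n → ℝ} {r : ℝ} (v : Fin n → ℝ)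
    (hz : ∀ l, |z l| ≤ r) : |∑ l, z l * softmax v l| ≤ r := by
  calc |∑ l, z l * softmax v l| ≤ ∑ l, |z l * softmax v l| := Finset.abs_sum_le_sum_abs _ _
    _ ≤ ∑ l, r * softmax v l := by
        refine Finset.sum_le_sum fun l _ => ?_
        rw [abs_mul, abs_of_nonneg (softmax_nonneg v l)]
        exact mul_le_mul_of_nonneg_right (hz l) (softmax_nonneg v l)
    _ = r := by rw [← Finset.mul_sum, sum_softmax, mul_one]

theorem sum_mul_softmax_eq_boltzmann {n : ℕ} {z : Fin n → ℝ} (hz : Function.Injective z) {κ : ℝ}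
    (hκ : κ ≠ 0) : ∑ l, z l * softmax (fun l => z l * κ) l =
      boltzmann (Finset.univ.image fun l => z l * κ) / κ := by
  have hinj : Function.Injective fun l => z l * κ := (mul_left_injective₀ hκ).comp hz
  unfold boltzmann softmax
  rw [Finset.sum_image hinj.injOn, Finset.sum_image hinj.injOn, div_div, Finset.sum_div]
  refine Finset.sum_congr rfl fun l _ => ?_
  field_simp

theorem l2Norm_add_le {m : ℕ} (x y : Fin m → ℝ) : l2Norm (x + y) ≤ l2Norm x + l2Norm y := by
  simpa [l2Norm] using norm_add_le (WithLp.toLp 2 x) (WithLp.toLp 2 y)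

theorem l2Norm_smul {m : ℕ} (a : ℝ) (x : Fin m → ℝ) : l2Norm (a • x) = |a| * l2Norm x := by
  simp [l2Norm, norm_smul]

theorem l2Norm_single {m : ℕ} (k : Fin m) : l2Norm (Pi.single k (1 : ℝ)) = 1 := by
  simp [l2Norm]

theorem abs_dotProduct_le_l2Norm {m : ℕ} (x v : Fin m → ℝ) : |x ⬝ᵥ v| ≤ l2Norm x * l2Norm v := by
  have := abs_real_inner_le_norm (WithLp.toLp 2 x) (WithLp.toLp 2 v)
  simpa [l2Norm, EuclideanSpace.inner_eq_star_dotProduct, dotProduct_comm] using this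

theorem rank_vecMulVec_eq_one {s d : ℕ} {w : Fin s → ℝ} {v : Fin d → ℝ} (hw : w ≠ 0)
    (hv : v ≠ 0) : (Matrix.vecMulVec w v).rank = 1 := by
  refine le_antisymm (Matrix.rank_vecMulVec_le w v) (Nat.one_le_iff_ne_zero.2 fun h => ?_)
  rw [Matrix.rank, Submodule.finrank_eq_zero, LinearMap.range_eq_bot] at h
  have h0 : Matrix.vecMulVec w v = 0 := Matrix.toLin'.injective (by
    rw [map_zero, Matrix.toLin'_apply', h])
  obtain ⟨i, hi⟩ := Function.ne_iff.1 hw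
  obtain ⟨j, hj⟩ := Function.ne_iff.1 hv
  exact mul_ne_zero hi hj (congrFun (congrFun h0 i) j)

/-- Columns of a single-head self-attention layer all of whose weight matrices are outer products
with the unit vector `e` on the head side. -/
theorem selfAttention_vecMulVec_col {d n s : ℕ} {e : Fin s → ℝ} (he : e ⬝ᵥ e = 1)
    (a v : Fin d → ℝ) (β : ℝ) (Z : Matrix (Fin d) (Fin n) ℝ) (k : Fin n) :
    (selfAttention (fun _ : Fin 1 => Matrix.vecMulVec a e) (fun _ => Matrix.vecMulVec e v)
      (fun _ => Matrix.vecMulVec e v) (fun _ => Matrix.vecMulVec (β • e) v) Z).col k =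
    Z.col k + (∑ l, (Z.col l ⬝ᵥ v) *
      softmax (fun l => (Z.col l ⬝ᵥ v) * (β * (Z.col k ⬝ᵥ v))) l) • a := by
  have hcol : ∀ l, Matrix.vecMul v Z l = Z.col l ⬝ᵥ v := fun l => by
    rw [dotProduct_comm]; rfl
  have hscore : (Matrix.vecMulVec e v * Z).transpose * (Matrix.vecMulVec (β • e) v * Z) =
      Matrix.of fun l k => (Z.col l ⬝ᵥ v) * (β * (Z.col k ⬝ᵥ v)) := by
    rw [Matrix.vecMulVec_mul, Matrix.vecMulVec_mul, Matrix.transpose_vecMulVec,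
      Matrix.vecMulVec_mul_vecMulVec]
    ext l k
    simp only [dotProduct_smul, he, Matrix.vecMulVec_apply, Pi.smul_apply, smul_eq_mul, hcol,
      Matrix.of_apply]
    ring
  have hval : Matrix.vecMulVec a e * (Matrix.vecMulVec e v * Z) =
      Matrix.vecMulVec a (Matrix.vecMul v Z) := by
    rw [Matrix.vecMulVec_mul e v, Matrix.vecMulVec_mul_vecMulVec, he, one_smul]
  ext i
  simp only [selfAttention, Finset.univ_unique, Finset.sum_const, Finset.card_singleton, one_smul,
    hval, hscore]
  rw [Matrix.vecMulVec_mul]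
  simp only [Matrix.col_apply, Matrix.add_apply, Matrix.vecMulVec_apply, Pi.add_apply,
    Pi.smul_apply, smul_eq_mul]
  rw [mul_comm (a i)]
  congr 2
  simp only [Matrix.vecMul, dotProduct, colSoftmax]
  refine Finset.sum_congr rfl fun l _ => ?_
  congr 1
  exact Finset.sum_congr rfl fun _ _ => mul_comm _ _

/-! ### Projecting the tokens -/

theorem vocabulary_finite {d n N : ℕ} (X : Fin N → Matrix (Fin d) (Fin n) ℝ) :
    (vocabulary X).Finite :=
  Set.finite_iUnion fun _ => Set.finite_range _

theorem col_mem_vocabulary {d n N : ℕ} (X : Fin N → Matrix (Fin d) (Fin n) ℝ) (i : Fin N)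
    (k : Fin n) : (X i).col k ∈ vocabulary X :=
  Set.mem_iUnion.2 ⟨i, k, rfl⟩

/-- A projection of all tokens to the line that almost preserves norms and distances. -/
theorem exists_token_projection {d n N : ℕ} (hd : 1 ≤ d) {rmin rmax ε c : ℝ} (hrmin : 0 < rmin)
    {X : Fin N → Matrix (Fin d) (Fin n) ℝ} (hsep : IsTokenwiseSeparated X rmin rmax ε)
    (hc : c = √(8 / (Real.pi * d)) / (((vocabulary X).ncard : ℝ) + 1) ^ 2) :
    ∃ v : Fin d → ℝ, v ≠ 0 ∧ (∀ i k, |(X i).col k ⬝ᵥ v| ≤ rmax) ∧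
      (∀ i k, c * rmin ≤ |(X i).col k ⬝ᵥ v|) ∧
      ∀ i j k l, (X i).col k ≠ (X j).col l →
        c * ε ≤ |(X i).col k ⬝ᵥ v - (X j).col l ⬝ᵥ v| := by
  have hc0 : 0 ≤ c := by rw [hc]; positivity
  by_cases hne : Nonempty (Fin N × Fin n)
  · obtain ⟨⟨i₀, k₀⟩⟩ := hne
    -- Adjoining `0`, which is not a token, turns the bound on distances into one on `|z k|` and
    -- accounts for `|𝒱| + 1`.
    set W : Finset (EuclideanSpace ℝ (Fin d)) :=
      insert 0 ((vocabulary_finite X).toFinset.image (WithLp.toLp 2)) with hW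
    have hVpos : 0 < (vocabulary X).ncard :=
      (Set.ncard_pos (vocabulary_finite X)).2 ⟨_, col_mem_vocabulary X i₀ k₀⟩
    have hcard : W.card = (vocabulary X).ncard + 1 := by
      rw [hW, Finset.card_insert_of_notMem,
        Finset.card_image_of_injective _ (WithLp.toLp_injective 2),
        Set.ncard_eq_toFinset_card _ (vocabulary_finite X)]
      intro h
      obtain ⟨x, hx, hx0⟩ := Finset.mem_image.1 h
      rw [Set.Finite.mem_toFinset] at hx
      obtain ⟨i, k, rfl⟩ := Set.mem_iUnion.1 hx
      have := hsep.lower i k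
      rw [l2Norm] at this
      simp only at hx0
      rw [hx0, norm_zero] at this
      linarith
    obtain ⟨v, hv1, hv⟩ := exists_projection hd (by omega)
      (fun i => ((W.equivFinOfCardEq hcard).symm i : EuclideanSpace ℝ (Fin d)))
      (Subtype.val_injective.comp (Equiv.injective _))
    have hv2 : ∀ x ∈ W, ∀ y ∈ W, c * ‖x - y‖ ≤ |inner ℝ (x - y) v| := by
      intro x hx y hy
      have := hv (W.equivFinOfCardEq hcard ⟨x, hx⟩) (W.equivFinOfCardEq hcard ⟨y, hy⟩)
      simp only [Equiv.symm_apply_apply] at this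
      rw [hc]
      push_cast at this
      exact this
    have hmem : ∀ i k, WithLp.toLp 2 ((X i).col k) ∈ W := fun i k =>
      Finset.mem_insert_of_mem (Finset.mem_image_of_mem _
        ((vocabulary_finite X).mem_toFinset.2 (col_mem_vocabulary X i k)))
    have hdot : ∀ x y : Fin d → ℝ, inner ℝ (WithLp.toLp 2 x - WithLp.toLp 2 y) v =
        x ⬝ᵥ v.ofLp - y ⬝ᵥ v.ofLp := fun x y => by
      simp [inner_sub_left, EuclideanSpace.inner_eq_star_dotProduct, dotProduct_comm]
    have hlow : ∀ i k, c * rmin ≤ |(X i).col k ⬝ᵥ v.ofLp| := by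
      intro i k
      have h := hv2 _ (hmem i k) _ (Finset.mem_insert_self 0 _)
      rw [← WithLp.toLp_zero 2, hdot, zero_dotProduct, sub_zero, WithLp.toLp_zero, sub_zero] at h
      exact (mul_le_mul_of_nonneg_left (hsep.lower i k).le hc0).trans h
    have hcpos : 0 < c := by rw [hc]; positivity
    refine ⟨v.ofLp, fun h0 => ?_, fun i k => ?_, hlow, fun i j k l hne => ?_⟩
    · have := hlow i₀ k₀
      rw [h0, dotProduct_zero, abs_zero] at this
      exact absurd this (not_le.2 (by positivity))
    · refine (abs_dotProduct_le_l2Norm _ _).trans ?_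
      refine (mul_le_of_le_one_right (norm_nonneg _) ?_).trans (hsep.upper i k).le
      exact hv1.le
    · have h := hv2 _ (hmem i k) _ (hmem j l)
      rw [hdot] at h
      refine le_trans (mul_le_mul_of_nonneg_left ?_ hc0) h
      exact (hsep.separated i j k l hne).le
  -- Without tokens any nonzero vector serves.
  · refine ⟨Pi.single ⟨0, hd⟩ 1, ?_, fun i k => absurd ⟨(i, k)⟩ hne,
      fun i k => absurd ⟨(i, k)⟩ hne, fun i _ k => absurd ⟨(i, k)⟩ hne⟩
    simp

/-! ### The contextual mapping -/

theorem theorem2 {d n N s : ℕ} (hd : 1 ≤ d) (hs : 1 ≤ s) {rmin rmax ε : ℝ}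
    (hrmin : 0 < rmin) (hε : 0 < ε)
    (X : Fin N → Matrix (Fin d) (Fin n) ℝ)
    (hdup : ∀ i k l, k ≠ l → (X i).col k ≠ (X i).col l)
    (hsep : IsTokenwiseSeparated X rmin rmax ε) :
    ∃ (WO : Matrix (Fin d) (Fin s) ℝ) (WV WK WQ : Matrix (Fin s) (Fin d) ℝ),
      WV.rank = 1 ∧ WK.rank = 1 ∧ WQ.rank = 1 ∧
      IsContextualMapping X
        (selfAttention (fun _ : Fin 1 => WO) (fun _ => WV) (fun _ => WK) (fun _ => WQ))
        (rmax + ε / 4)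
        (2 * (Real.log n) ^ 2 * ε ^ 2 * rmin /
            (rmax ^ 2 * (((vocabulary X).ncard : ℝ) + 1) ^ 4 * (2 * Real.log n + 3)
              * Real.pi * d) *
          Real.exp (-((((vocabulary X).ncard : ℝ) + 1) ^ 4 *
            ((2 * Real.log n + 3) * Real.pi * d * rmax ^ 2 / (4 * ε * rmin))))) := by
  obtain ⟨c, hc⟩ : ∃ c : ℝ,
    c = √(8 / (Real.pi * d)) / (((vocabulary X).ncard : ℝ) + 1) ^ 2 := ⟨_, rfl⟩
  obtain ⟨v, hv0, hup, hlow, hsepv⟩ := exists_token_projection hd hrmin hsep hc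
  have hpi := Real.pi_pos
  have hpi3 := Real.pi_gt_three
  have hd1 : (1 : ℝ) ≤ d := by exact_mod_cast hd
  have hl : 0 ≤ Real.log n := Real.log_natCast_nonneg n
  set M : ℝ := ((vocabulary X).ncard : ℝ) + 1 with hM
  have hM1 : 1 ≤ M := by rw [hM]; linarith [Nat.cast_nonneg (α := ℝ) (vocabulary X).ncard]
  have hM2 : 0 < N → 0 < n → 2 ≤ M := fun hN hn => by
    have : 1 ≤ (vocabulary X).ncard :=
      (Set.ncard_pos (vocabulary_finite X)).2 ⟨_, col_mem_vocabulary X ⟨0, hN⟩ ⟨0, hn⟩⟩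
    have : (1 : ℝ) ≤ (vocabulary X).ncard := by exact_mod_cast this
    linarith
  set L : ℝ := 2 * Real.log n + 3 with hL
  have hLpos : 0 < L := by linarith
  have hcpos : 0 < c := by rw [hc]; positivity
  have hc2 : c ^ 2 * (M ^ 4 * Real.pi * d) = 8 := by
    rw [hc, div_pow, Real.sq_sqrt (by positivity)]
    field_simp
  -- Chosen so that `(c * ε) * (β * c * rmin) = L`: projected gap times least `|κ|` is exactly the
  -- required spacing.
  set β : ℝ := L * M ^ 4 * Real.pi * d / (8 * ε * rmin) with hβ
  have hβpos : 0 < β := by positivity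
  have hβc : β * c ^ 2 * (rmin * ε) = L := by
    calc β * c ^ 2 * (rmin * ε) = L * (c ^ 2 * (M ^ 4 * Real.pi * d)) / 8 := by
          rw [hβ]; field_simp
      _ = L := by rw [hc2]; ring
  set e : Fin s → ℝ := Pi.single ⟨0, hs⟩ 1 with he
  have hee : e ⬝ᵥ e = 1 := by simp [he]
  have he0 : e ≠ 0 := fun h => by simp [h] at hee
  set u : Fin d → ℝ := Pi.single ⟨0, hd⟩ 1 with hu
  have hu1 : l2Norm u = 1 := l2Norm_single _
  set α : ℝ := ε / (4 * rmax) with hα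
  have hrank : ∀ w : Fin s → ℝ, w ≠ 0 → (Matrix.vecMulVec w v).rank = 1 := fun w hw =>
    rank_vecMulVec_eq_one hw hv0
  refine ⟨Matrix.vecMulVec (α • u) e, Matrix.vecMulVec e v, Matrix.vecMulVec e v,
    Matrix.vecMulVec (β • e) v, hrank e he0, hrank e he0,
    hrank _ (smul_ne_zero hβpos.ne' he0), ?_⟩
  set g : Fin N → Fin n → ℝ := fun i k => ∑ l, ((X i).col l ⬝ᵥ v) *
      softmax (fun l => ((X i).col l ⬝ᵥ v) * (β * ((X i).col k ⬝ᵥ v))) l with hg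
  have hF : ∀ i k, (selfAttention (fun _ : Fin 1 => Matrix.vecMulVec (α • u) e)
      (fun _ => Matrix.vecMulVec e v) (fun _ => Matrix.vecMulVec e v)
      (fun _ => Matrix.vecMulVec (β • e) v) (X i)).col k =
      (X i).col k + (α * g i k) • u := fun i k => by
    rw [selfAttention_vecMulVec_col hee, smul_smul, mul_comm α]
  have hrmax : ∀ (_ : Fin N) (_ : Fin n), 0 < rmax := fun i k =>
    hrmin.trans ((hsep.lower i k).trans (hsep.upper i k))
  have hgle : ∀ i k, |g i k| ≤ rmax := fun i k => by
    have : NeZero n := ⟨fun h => by subst h; exact k.elim0⟩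
    exact abs_sum_mul_softmax_le _ fun l => hup i l
  have hαg : ∀ i k, |α * g i k| ≤ ε / 4 := fun i k => by
    have hr := hrmax i k
    rw [abs_mul, abs_of_pos (by positivity : 0 < α)]
    calc α * |g i k| ≤ α * rmax := by
          have := hgle i k
          gcongr
      _ = ε / 4 := by rw [hα]; field_simp
  constructor
  · intro i k
    rw [hF]
    refine (l2Norm_add_le _ _).trans_lt ?_
    rw [l2Norm_smul, hu1, mul_one]
    exact add_lt_add_of_lt_of_le (hsep.upper i k) (hαg i k)
  · intro i j k l hij
    have hr := hrmax i k
    -- All scores lie in `[-R, R]` for `R = β * rmax ^ 2`, and `|κ| ≤ β * rmax`; thus `δ` is the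
    -- Boltzmann gap scaled by the least possible `α / |κ|`.
    have hδ : 2 * (Real.log n) ^ 2 * ε ^ 2 * rmin / (rmax ^ 2 * M ^ 4 * L * Real.pi * d) *
          Real.exp (-(M ^ 4 * (L * Real.pi * d * rmax ^ 2 / (4 * ε * rmin)))) =
        α / (β * rmax) * ((Real.log n) ^ 2 * Real.exp (-2 * (β * rmax ^ 2))) := by
      have h1 : -(M ^ 4 * (L * Real.pi * d * rmax ^ 2 / (4 * ε * rmin))) =
          -2 * (β * rmax ^ 2) := by
        rw [hβ]; field_simp; norm_num
      have h2 : 2 * (Real.log n) ^ 2 * ε ^ 2 * rmin / (rmax ^ 2 * M ^ 4 * L * Real.pi * d) =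
          α / (β * rmax) * (Real.log n) ^ 2 := by
        rw [hα, hβ]; field_simp; ring
      rw [h1, h2]; ring
    rw [hδ, hF, hF]
    by_cases hkl : (X i).col k = (X j).col l
    · have hV : seqVocabulary (X i) ≠ seqVocabulary (X j) :=
        hij.resolve_right fun h => h hkl
      set κ : ℝ := β * ((X i).col k ⬝ᵥ v) with hκ
      have hκlow : β * (c * rmin) ≤ |κ| := by
        rw [hκ, abs_mul, abs_of_pos hβpos]
        exact mul_le_mul_of_nonneg_left (hlow i k) hβpos.le
      have hκup : |κ| ≤ β * rmax := by
        rw [hκ, abs_mul, abs_of_pos hβpos]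
        exact mul_le_mul_of_nonneg_left (hup i k) hβpos.le
      have hκpos : 0 < |κ| := lt_of_lt_of_le (by positivity) hκlow
      have hκ0 : κ ≠ 0 := abs_pos.1 hκpos
      have hcol : ∀ i j k l, (X i).col k ⬝ᵥ v = (X j).col l ⬝ᵥ v → (X i).col k = (X j).col l := by
        intro i j k l h
        by_contra hne
        have := hsepv i j k l hne
        rw [h, sub_self, abs_zero] at this
        exact absurd this (not_le.2 (by positivity))
      have hinj : ∀ i, Function.Injective fun k => (X i).col k ⬝ᵥ v := fun i k l h => by
        by_contra hne
        exact hdup i k l hne (hcol i i k l h)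
      have hgi : g i k = boltzmann (Finset.univ.image fun k => ((X i).col k ⬝ᵥ v) * κ) / κ :=
        sum_mul_softmax_eq_boltzmann (hinj i) hκ0
      have hgj : g j l = boltzmann (Finset.univ.image fun k => ((X j).col k ⬝ᵥ v) * κ) / κ := by
        rw [hκ, hkl] at *
        exact sum_mul_softmax_eq_boltzmann (hinj j) hκ0
      have hcard : ∀ i, (Finset.univ.image fun k => ((X i).col k ⬝ᵥ v) * κ).card = n := fun i => by
        have := (mul_left_injective₀ hκ0).comp (hinj i)
        exact (Finset.card_image_of_injective _ this).trans (Fintype.card_fin n)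
      have hbd : ∀ i, ∀ x ∈ Finset.univ.image (fun k => ((X i).col k ⬝ᵥ v) * κ),
          |x| ≤ β * rmax ^ 2 := by
        intro i x hx
        obtain ⟨k, -, rfl⟩ := Finset.mem_image.1 hx
        rw [abs_mul]
        calc _ ≤ rmax * (β * rmax) := mul_le_mul (hup i k) hκup (abs_nonneg _) hr.le
          _ = _ := by ring
      have hmem : ∀ x ∈ (Finset.univ.image fun k => ((X i).col k ⬝ᵥ v) * κ) ∪
          (Finset.univ.image fun k => ((X j).col k ⬝ᵥ v) * κ),
          ∃ i k, ((X i).col k ⬝ᵥ v) * κ = x := by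
        intro x hx
        rcases Finset.mem_union.1 hx with h | h <;>
        · obtain ⟨k, -, h⟩ := Finset.mem_image.1 h
          exact ⟨_, k, h⟩
      have key := boltzmann_gap (hcard i) (hcard j) (R := β * rmax ^ 2) (by
          intro h
          have hsub : ∀ i j, (Finset.univ.image fun k => ((X i).col k ⬝ᵥ v) * κ) =
              (Finset.univ.image fun k => ((X j).col k ⬝ᵥ v) * κ) →
              seqVocabulary (X i) ⊆ seqVocabulary (X j) := by
            rintro i j h _ ⟨k, rfl⟩
            have hk := h ▸ Finset.mem_image_of_mem (fun k => ((X i).col k ⬝ᵥ v) * κ)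
              (Finset.mem_univ k)
            obtain ⟨l, -, hl⟩ := Finset.mem_image.1 hk
            exact ⟨l, hcol _ _ _ _ (mul_right_cancel₀ hκ0 hl)⟩
          exact hV ((hsub i j h).antisymm (hsub j i h.symm))) (hbd i) (hbd j) (by
          intro x hx y hy hxy
          obtain ⟨i₁, k₁, rfl⟩ := hmem x hx
          obtain ⟨i₂, k₂, rfl⟩ := hmem y hy
          have hne : (X i₁).col k₁ ≠ (X i₂).col k₂ := fun h => hxy (by rw [h])
          rw [← sub_mul, abs_mul]
          calc 2 * Real.log n + 3 = (c * ε) * (β * (c * rmin)) := by rw [← hL, ← hβc]; ring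
            _ ≤ _ := mul_le_mul (hsepv i₁ i₂ k₁ k₂ hne) hκlow (by positivity) (abs_nonneg _))
      rw [hkl, add_sub_add_left_eq_sub, ← sub_smul, ← mul_sub, l2Norm_smul, hu1, mul_one, hgi, hgj,
        ← sub_div, abs_mul, abs_div _ κ, abs_of_pos (by positivity : 0 < α)]
      calc α / (β * rmax) * ((Real.log n) ^ 2 * Real.exp (-2 * (β * rmax ^ 2)))
          < α / (β * rmax) * _ := mul_lt_mul_of_pos_left key (by positivity)
        _ ≤ α / |κ| * _ := by gcongr
        _ = _ := by ring
    -- Two shifts of at most `ε / 4` leave a distance above `ε / 2`, so it remains to see that `δ ≤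
    -- ε / 2`. This follows from `2 * R ≥ L ≥ 3`.
    · have hdist := hsep.separated i j k l hkl
      have hε2 : ε < 2 * rmax := by
        have h1 := l2Norm_add_le ((X i).col k) ((-1 : ℝ) • (X j).col l)
        rw [l2Norm_smul, neg_one_smul, ← sub_eq_add_neg] at h1
        have h2 := hsep.upper i k
        have h3 := hsep.upper j l
        norm_num at h1
        linarith
      have hrr : rmin < rmax := (hsep.lower i k).trans (hsep.upper i k)
      have hc1 : c ^ 2 ≤ 1 := by
        have h2 : 2 ≤ M := hM2 i.pos k.pos
        have h3 : (8 : ℝ) ≤ M ^ 4 * Real.pi * d := by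
          calc (8 : ℝ) ≤ 2 ^ 4 * 3 * 1 := by norm_num
            _ ≤ _ := by gcongr
        nlinarith [sq_nonneg c]
      have hR : L ≤ 2 * (β * rmax ^ 2) := by
        calc L = β * c ^ 2 * (rmin * ε) := hβc.symm
          _ ≤ β * 1 * (rmax * (2 * rmax)) := by gcongr
          _ = _ := by ring
      have hexp : (Real.log n) ^ 2 * Real.exp (-2 * (β * rmax ^ 2)) ≤ 2 := by
        calc _ ≤ 2 * Real.exp (Real.log n) * Real.exp (-Real.log n) :=
              mul_le_mul (sq_le_two_mul_exp hl) (Real.exp_le_exp.2 (by linarith))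
                (Real.exp_pos _).le (by positivity)
          _ = 2 := by rw [mul_assoc, ← Real.exp_add]; simp
      have hδle : α / (β * rmax) * ((Real.log n) ^ 2 * Real.exp (-2 * (β * rmax ^ 2))) ≤
          ε / 2 := by
        have h1 : α / (β * rmax) = ε / (4 * (β * rmax ^ 2)) := by rw [hα]; field_simp
        rw [h1, div_mul_eq_mul_div, div_le_div_iff₀ (by positivity) two_pos, mul_assoc]
        refine mul_le_mul_of_nonneg_left ?_ hε.le
        linarith
      refine hδle.trans_lt ?_
      have h1 := l2Norm_add_le ((X i).col k + (α * g i k) • u - ((X j).col l + (α * g j l) • u))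
        ((α * g j l - α * g i k) • u)
      have h2 : (X i).col k + (α * g i k) • u - ((X j).col l + (α * g j l) • u) +
          (α * g j l - α * g i k) • u = (X i).col k - (X j).col l := by
        rw [sub_smul]; abel
      rw [h2, l2Norm_smul, hu1, mul_one] at h1
      have h3 := abs_sub (α * g j l) (α * g i k)
      have h4 := hαg i k
      have h5 := hαg j l
      linarith
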